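/- Let $n\ge 1$, $\alpha>0$ and $1\le p<\infty$. On $\mathbb C^n$ put $\langle z,w\rangle=\sum_j z_j\overline{w_j}$, let $dV$ be Lebesgue measure and $D(z,\delta)=\{w:|z-w|<\delta\}$. For $1\le p<\infty$ let $\mathcal F^p_\alpha$ be the space of entire functions $f$ with $$\|f\|_{(p,\alpha)}^p=\Big(\frac{\alpha p}{2\pi}\Big)^n\int_{\mathbb C^n}|f(z)|^pe^{-\frac{\alpha p}{2}|z|^2}\,dV(z)<\infty ,$$ and $\mathcal F^\infty_\alpha$ the space of entire $f$ with $\|f\|_{(\infty,\alpha)}=\sup_z|f(z)|e^{-\frac\alpha2|z|^2}<\infty$. Put $K_w(z)=e^{\alpha\langle z,w\rangle}$ and $k_w(z)=e^{\alpha\langle z,w\rangle-\alpha|w|^2/2}$. Let $\mu$ be a nonnegative Borel measure on $\mathbb C^n$ that is admissible: $\int|K_w(z)|^2e^{-\alpha|w|^2}\,d\mu(w)<\infty$ for every $z\in\mathbb C^n$. The Toeplitz operator $T_\mu f(z)=\int K_w(z)f(w)e^{-\alpha|w|^2}\,d\mu(w)$ is considered on its natural domain in $\mathcal F^p_\alpha$,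 the set of $f\in\mathcal F^p_\alpha$ for which this integral converges absolutely for every $z$. It is bounded from $\mathcal F^p_\alpha$ to $\mathcal F^\infty_\alpha$ if, for some finite $C$ and every $f$ in this domain, $T_\mu f\in\mathcal F^\infty_\alpha$ and $\|T_\mu f\|_{(\infty,\alpha)}\le C\|f\|_{(p,\alpha)}$; $\|T_\mu\|$ is the supremum of $\|T_\mu f\|_{(\infty,\alpha)}$ over $f$ in this domain with $\|f\|_{(p,\alpha)}\le1$. For finite $q$, $\mu$ is a $(1,q)$ Fock–Carleson measure if, for some finite $C$, $\int|f|^qe^{-\frac{\alpha q}2|z|^2}d\mu(z)\le C\|f\|_{(1,\alpha)}^q$ for all $f\in\mathcal F^1_\alpha$. For $t>0$ let $\widetilde\mu_t(w)=\int|k_w(z)|^te^{-\frac{t\alpha}2|z|^2}d\mu(z)$. For $r>0$, an $r/2$-lattice is a sequence $(z_k)$ in $\mathbb C^n$ such that the balls $D(z_k,r/2)$ cover $\mathbb C^n$ and the balls $D(z_k,r/4)$ are mutually disjoint. The following statements are equivalent: 1. $T_\mu:\mathcal F^p_\alpha\to\mathcal F^\infty_\alpha$ is bounded (equivalently: it is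 bounded and, moreover, its domain is all of $\mathcal F^p_\alpha$); 2. $\mu$ is a $(1,q)$ Fock–Carleson measure for some (equivalently, for any) finite $q\ge p$; 3. $\mu(D(\cdot,\delta))\in L^\infty(\mathbb C^n,dV)$ for some (equivalently, for any) $\delta>0$; 4. $\widetilde\mu_t\in L^\infty(\mathbb C^n,dV)$ for some (equivalently, for any) $t>0$; 5. $(\mu(D(z_k,r)))_k\in\ell^\infty$ for some $r>0$ and some $r/2$-lattice $(z_k)$ (equivalently, for any $r>0$ and any $r/2$-lattice $(z_k)$). Furthermore, for all $\delta,t,r>0$ there is a finite constant $C$, depending only on $n,\alpha,p,\delta,t,r$, such that for every admissible $\mu$ and every $r/2$-lattice $(z_k)$ any two of the five quantities $$\|T_\mu\|,\quad \|I_\mu\|,\quad \|\widetilde\mu_t\|_{L^\infty},\quad \|\mu(D(\cdot,\delta))\|_{L^\infty},\quad \|(\mu(D(z_k,r)))_k\|_{\ell^\infty}$$ in $[0,\infty]$ are at most $C$ times each other. Here $I_\mu$ is the embedding of $\mathcal F^1_\alpha$ into $L^1(\sigma_1)$, $d\sigma_1(z)=e^{-\frac\alpha2|z|^2}d\mu(z)$,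 and $\|I_\mu\|=\sup\{\int|f|\,d\sigma_1: f\in\mathcal F^1_\alpha,\ \|f\|_{(1,\alpha)}\le1\}$. -/

import Mathlib

open MeasureTheory Filter Topology
open scoped ENNReal NNReal

noncomputable section

/-- `ℂⁿ` with its Hermitian inner product, Euclidean norm and Lebesgue measure `volume`. -/
abbrev Cn (n : ℕ) : Type := EuclideanSpace ℂ (Fin n)

/-- The kernel `K_w(z) = exp (α ⟨z, w⟩)`, where `⟨z, w⟩ = ∑ j, z_j * conj w_j`.
In Mathlib the first slot of `inner` is the conjugate-linear one. -/
def fockKernel {n : ℕ} (α : ℝ) (w z : Cn n) : ℂ :=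
  Complex.exp ((α : ℂ) * inner ℂ w z)

/-- The normalized kernel `k_w(z) = exp (α ⟨z, w⟩ - α |w|² / 2)`. -/
def normalizedFockKernel {n : ℕ} (α : ℝ) (w z : Cn n) : ℂ :=
  Complex.exp ((α : ℂ) * inner ℂ w z - ((α * ‖w‖ ^ 2 / 2 : ℝ) : ℂ))

/-- The weighted integral `∫ |f(z)|^q exp (-(α q / 2) |z|²) dν(z)`, with values in `[0, ∞]`. -/
def weightedIntegral {n : ℕ} (α q : ℝ) (ν : Measure (Cn n)) (f : Cn n → ℂ) : ℝ≥0∞ :=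
  ∫⁻ z, ‖f z‖ₑ ^ q * ENNReal.ofReal (Real.exp (-(α * q / 2) * ‖z‖ ^ 2)) ∂ν

/-- The norm of the Fock space `F^p_α`, `p` finite:
`‖f‖_{(p,α)} = ((α p / (2 π))^n ∫ |f(z)|^p exp (-(α p / 2) |z|²) dV(z))^(1/p)`. -/
def fockNorm {n : ℕ} (α p : ℝ) (f : Cn n → ℂ) : ℝ≥0∞ :=
  (ENNReal.ofReal ((α * p / (2 * Real.pi)) ^ n) * weightedIntegral α p volume f) ^ (1 / p)

/-- The norm of `F^∞_α`: `sup_z |f(z)| exp (-(α / 2) |z|²)`. -/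
def fockSupNorm {n : ℕ} (α : ℝ) (f : Cn n → ℂ) : ℝ≥0∞ :=
  ⨆ z, ‖f z‖ₑ * ENNReal.ofReal (Real.exp (-(α / 2) * ‖z‖ ^ 2))

/-- The Fock space `F^p_α`, `p` finite: entire functions of finite norm. -/
def fockSpace (n : ℕ) (α p : ℝ) : Set (Cn n → ℂ) :=
  {f | Differentiable ℂ f ∧ fockNorm α p f < ∞}

/-- The growth type Fock space `F^∞_α`: entire functions of finite norm. -/
def fockSupSpace (n : ℕ) (α : ℝ) : Set (Cn n → ℂ) :=
  {f | Differentiable ℂ f ∧ fockSupNorm α f < ∞}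

/-- The admissibility condition: `∫ |K_w(z)|² exp (-α |w|²) dμ(w) < ∞` for every `z`. -/
def IsAdmissible {n : ℕ} (α : ℝ) (μ : Measure (Cn n)) : Prop :=
  ∀ z : Cn n,
    ∫⁻ w, ‖fockKernel α w z‖ₑ ^ 2 * ENNReal.ofReal (Real.exp (-α * ‖w‖ ^ 2)) ∂μ < ∞

/-- The integrand `K_w(z) f(w) exp (-α |w|²)` of the Toeplitz operator. -/
def toeplitzIntegrand {n : ℕ} (α : ℝ) (f : Cn n → ℂ) (z w : Cn n) : ℂ :=
  fockKernel α w z * f w * ((Real.exp (-α * ‖w‖ ^ 2) : ℝ) : ℂ)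

/-- The Toeplitz operator `T_μ f(z) = ∫ K_w(z) f(w) exp (-α |w|²) dμ(w)`. -/
def toeplitz {n : ℕ} (α : ℝ) (μ : Measure (Cn n)) (f : Cn n → ℂ) (z : Cn n) : ℂ :=
  ∫ w, toeplitzIntegrand α f z w ∂μ

/-- The natural domain of `T_μ` in `F^p_α`: those `f` for which the integral defining `T_μ f(z)`
converges absolutely for every `z`. For an admissible `μ` it contains all kernel functions. -/
def toeplitzDomain {n : ℕ} (α p : ℝ) (μ : Measure (Cn n)) : Set (Cn n → ℂ) :=
  {f | f ∈ fockSpace n α p ∧ ∀ z, Integrable (toeplitzIntegrand α f z) μ}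

/-- Boundedness of the (densely defined) operator `T_μ : F^p_α → F^∞_α`: on its natural domain it
takes values in `F^∞_α` and satisfies `‖T_μ f‖_{(∞,α)} ≤ C ‖f‖_{(p,α)}`. -/
def IsBoundedToeplitz {n : ℕ} (α p : ℝ) (μ : Measure (Cn n)) : Prop :=
  ∃ C : ℝ≥0, ∀ f ∈ toeplitzDomain α p μ,
    toeplitz α μ f ∈ fockSupSpace n α ∧ fockSupNorm α (toeplitz α μ f) ≤ C * fockNorm α p f

/-- The operator norm of `T_μ : F^p_α → F^∞_α`, with values in `[0, ∞]`. -/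
def toeplitzNorm {n : ℕ} (α p : ℝ) (μ : Measure (Cn n)) : ℝ≥0∞ :=
  ⨆ f ∈ {f | f ∈ toeplitzDomain α p μ ∧ fockNorm α p f ≤ 1}, fockSupNorm α (toeplitz α μ f)

/-- `μ` is a `(p, q)` Fock–Carleson measure:
`∫ |f(z)|^q exp (-(α q / 2) |z|²) dμ(z) ≤ C ‖f‖_{(p,α)}^q` for all `f` in `F^p_α`. -/
def IsFockCarleson {n : ℕ} (α p q : ℝ) (μ : Measure (Cn n)) : Prop :=
  ∃ C : ℝ≥0, ∀ f ∈ fockSpace n α p, weightedIntegral α q μ f ≤ C * fockNorm α p f ^ q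

/-- The norm, in `[0, ∞]`, of the embedding `I_μ : F^p_α → L^q(σ_q)`,
where `dσ_q(z) = exp (-(α q / 2) |z|²) dμ(z)`. -/
def embeddingNorm {n : ℕ} (α p q : ℝ) (μ : Measure (Cn n)) : ℝ≥0∞ :=
  ⨆ f ∈ {f | f ∈ fockSpace n α p ∧ fockNorm α p f ≤ 1}, weightedIntegral α q μ f ^ (1 / q)

/-- The `t`-Berezin transform `w ↦ ∫ |k_w(z)|^t exp (-(t α / 2) |z|²) dμ(z)`. -/
def berezin {n : ℕ} (α t : ℝ) (μ : Measure (Cn n)) (w : Cn n) : ℝ≥0∞ :=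
  ∫⁻ z, ‖normalizedFockKernel α w z‖ₑ ^ t *
    ENNReal.ofReal (Real.exp (-(t * α / 2) * ‖z‖ ^ 2)) ∂μ

/-- The averaging function `z ↦ μ(D(z, δ))`, where `D(z, δ) = {w | |z - w| < δ}`. -/
def averaging {n : ℕ} (δ : ℝ) (μ : Measure (Cn n)) (z : Cn n) : ℝ≥0∞ :=
  μ (Metric.ball z δ)

/-- `z` is an `r/2`-lattice: the balls `D(z_k, r/2)` cover `ℂⁿ` and the balls `D(z_k, r/4)` are
mutually disjoint. -/
def IsHalfLattice {n : ℕ} (r : ℝ) (z : ℕ → Cn n) : Prop :=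
  (⋃ k, Metric.ball (z k) (r / 2)) = Set.univ ∧
    Pairwise fun j k => Disjoint (Metric.ball (z j) (r / 4)) (Metric.ball (z k) (r / 4))

end

-- Every condition is compared with one number, the supremum S of the averages `μ (D(u, δ))`. Two
-- facts carry the proof. Lower bounds come from testing on normalized kernels. They have norm 1 in
-- every space, and their weighted modulus is exactly a Gaussian
-- (`weightedAbs_normalizedFockKernel`). Hence the embedding and the Berezin transforms produce
-- Gaussian transforms of `μ`, and so does `T_μ k_w` evaluated at `w`, where the integrand is
-- positive. A Gaussian transform dominates averages (`averaging_le_gaussianTransform`). Upper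
-- bounds come from the submean value property of the weighted modulus
-- (`weightedAbs_le_lintegral_ball`) and Tonelli. They give the Carleson embedding
-- (`exists_weightedIntegral_le_averaging`), while the same averaging of a Gaussian gives
-- `exists_gaussianTransform_le_averaging`. Since point evaluations embed `F^p_α` into `F^∞_α`, the
-- weighted modulus of `T_μ f` is at most a constant times the norm of `f` times a Gaussian
-- transform.

variable {n : ℕ}

/-- The weighted modulus `|f(z)| exp (-(α / 2) |z|²)`. -/
noncomputable def weightedAbs {n : ℕ} (α : ℝ) (f : Cn n → ℂ) (z : Cn n) : ℝ≥0∞ :=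
  ‖f z‖ₑ * ENNReal.ofReal (Real.exp (-(α / 2) * ‖z‖ ^ 2))

/-- The Gaussian transform `w ↦ ∫ exp (-c |z - w|²) dμ(z)`. -/
noncomputable def gaussianTransform {n : ℕ} (c : ℝ) (μ : Measure (Cn n)) (w : Cn n) : ℝ≥0∞ :=
  ∫⁻ z, ENNReal.ofReal (Real.exp (-c * ‖z - w‖ ^ 2)) ∂μ

-- Weighted modulus and normalized kernels

lemma ofReal_exp_mul_ofReal_exp (a b : ℝ) :
    ENNReal.ofReal (Real.exp a) * ENNReal.ofReal (Real.exp b) =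
      ENNReal.ofReal (Real.exp (a + b)) := by
  rw [Real.exp_add, ENNReal.ofReal_mul (Real.exp_nonneg _)]

lemma ofReal_exp_rpow (a q : ℝ) :
    ENNReal.ofReal (Real.exp a) ^ q = ENNReal.ofReal (Real.exp (a * q)) := by
  rw [ENNReal.ofReal_rpow_of_pos (Real.exp_pos _), Real.exp_mul]

lemma enorm_cexp (x : ℂ) : ‖Complex.exp x‖ₑ = ENNReal.ofReal (Real.exp x.re) := by
  rw [← ofReal_norm, Complex.norm_exp]


lemma norm_sub_sq_complex (z w : Cn n) :
    ‖z - w‖ ^ 2 = ‖z‖ ^ 2 - 2 * (inner ℂ w z : ℂ).re + ‖w‖ ^ 2 := by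
  have := norm_sub_sq (𝕜 := ℂ) z w
  rw [this, inner_re_symm]
  rfl

lemma weightedAbs_rpow {q : ℝ} (hq : 0 ≤ q) (α : ℝ) (f : Cn n → ℂ) (z : Cn n) :
    ‖f z‖ₑ ^ q * ENNReal.ofReal (Real.exp (-(α * q / 2) * ‖z‖ ^ 2)) = weightedAbs α f z ^ q := by
  rw [weightedAbs, ENNReal.mul_rpow_of_nonneg _ _ hq, ofReal_exp_rpow]
  congr 3
  ring_nf

lemma weightedIntegral_eq {q : ℝ} (hq : 0 ≤ q) (α : ℝ) (ν : Measure (Cn n)) (f : Cn n → ℂ) :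
    weightedIntegral α q ν f = ∫⁻ z, weightedAbs α f z ^ q ∂ν := by
  simp only [weightedIntegral, weightedAbs_rpow hq]

/-- Completing the square: the weights turn `Re ⟨z, w⟩` into `|z - w|²`. -/
lemma weightedAbs_normalizedFockKernel (α : ℝ) (w z : Cn n) :
    weightedAbs α (normalizedFockKernel α w) z =
      ENNReal.ofReal (Real.exp (-(α / 2) * ‖z - w‖ ^ 2)) := by
  rw [weightedAbs, normalizedFockKernel, enorm_cexp, ofReal_exp_mul_ofReal_exp]
  congr 2
  rw [norm_sub_sq_complex, Complex.sub_re, Complex.re_ofReal_mul, Complex.ofReal_re]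
  ring

lemma berezin_eq {t : ℝ} (ht : 0 ≤ t) (α : ℝ) (μ : Measure (Cn n)) (w : Cn n) :
    berezin α t μ w = gaussianTransform (t * α / 2) μ w := by
  unfold berezin gaussianTransform
  congr 1 with z
  rw [mul_comm t α, weightedAbs_rpow ht, weightedAbs_normalizedFockKernel, ofReal_exp_rpow]
  congr 2
  ring

lemma measurable_weightedAbs (α : ℝ) {f : Cn n → ℂ} (hf : Continuous f) :
    Measurable (weightedAbs α f) := by
  unfold weightedAbs
  fun_prop

lemma gaussianTransform_volume {c : ℝ} (hc : 0 < c) (w : Cn n) :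
    gaussianTransform c volume w = ENNReal.ofReal ((Real.pi / c) ^ n) := by
  have h := GaussianFourier.integral_rexp_neg_mul_sq_norm (V := Cn n) hc
  have hr : Module.finrank ℝ (Cn n) = 2 * n := by
    rw [finrank_real_of_complex, finrank_euclideanSpace_fin]
  have hpos : 0 < (Real.pi / c) ^ n := by have := Real.pi_pos; positivity
  rw [hr, Nat.cast_mul, Nat.cast_ofNat, mul_div_cancel_left₀ _ (by norm_num : (2 : ℝ) ≠ 0),
    Real.rpow_natCast] at h
  unfold gaussianTransform
  rw [lintegral_sub_right_eq_self (fun z : Cn n => ENNReal.ofReal (Real.exp (-c * ‖z‖ ^ 2))),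
    ← ofReal_integral_eq_lintegral_ofReal, h]
  -- Integrability comes from the value: a non-integrable function would have integral 0, not a
  -- positive number.
  · by_contra hi
    rw [integral_undef hi] at h
    exact hpos.ne h
  · exact Eventually.of_forall fun z => (Real.exp_pos _).le

lemma differentiable_normalizedFockKernel (α : ℝ) (w : Cn n) :
    Differentiable ℂ (normalizedFockKernel α w) := by
  have : Differentiable ℂ fun z : Cn n => (inner ℂ w z : ℂ) :=
    (innerSL ℂ w).differentiable
  unfold normalizedFockKernel
  fun_prop

lemma fockNorm_normalizedFockKernel {α p : ℝ} (hα : 0 < α) (hp : 0 < p) (w : Cn n) :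
    fockNorm α p (normalizedFockKernel α w) = 1 := by
  have h : weightedIntegral α p volume (normalizedFockKernel α w) =
      gaussianTransform (α * p / 2) volume w := by
    rw [weightedIntegral_eq hp.le, gaussianTransform]
    congr 1 with z
    rw [weightedAbs_normalizedFockKernel, ofReal_exp_rpow]
    congr 2
    ring
  have hπ := Real.pi_pos
  rw [fockNorm, h, gaussianTransform_volume (by positivity), ← ENNReal.ofReal_mul (by positivity),
    ← mul_pow]
  have : α * p / (2 * Real.pi) * (Real.pi / (α * p / 2)) = 1 := by
    field_simp
  simp [this]

lemma normalizedFockKernel_mem_fockSpace {α p : ℝ} (hα : 0 < α) (hp : 0 < p) (w : Cn n) :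
    normalizedFockKernel α w ∈ fockSpace n α p :=
  ⟨differentiable_normalizedFockKernel α w, by simp [fockNorm_normalizedFockKernel hα hp]⟩

-- Mean value inequalities and point evaluations

/-- The circle mean value inequality along the complex line through `z` with direction `v`. -/
lemma enorm_le_lintegral_circle {g : Cn n → ℂ} (hg : Differentiable ℂ g) (z v : Cn n) :
    ENNReal.ofReal (2 * Real.pi) * ‖g z‖ₑ ≤
      ∫⁻ θ in Set.Ioc 0 (2 * Real.pi), ‖g (z + Complex.exp (θ * Complex.I) • v)‖ₑ := by
  have hπ := Real.pi_pos
  have hφ : Differentiable ℂ fun ζ : ℂ => g (z + ζ • v) := by fun_prop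
  have h := DiffContOnCl.circleAverage (c := 0) (R := 1) hφ.diffContOnCl
  rw [Real.circleAverage, intervalIntegral.integral_of_le (by positivity)] at h
  simp only [zero_smul, add_zero, circleMap, Complex.ofReal_one, one_mul, zero_add] at h
  rw [← h, enorm_smul, ← mul_assoc]
  have h1 : ENNReal.ofReal (2 * Real.pi) * ‖(2 * Real.pi)⁻¹‖ₑ = 1 := by
    rw [Real.enorm_eq_ofReal (by positivity), ← ENNReal.ofReal_mul (by positivity),
      mul_inv_cancel₀ (by positivity), ENNReal.ofReal_one]
  rw [h1, one_mul]
  exact enorm_integral_le_lintegral_enorm _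

/-- Multiplication by `exp (i θ)` as a real linear isometry. -/
noncomputable def rotationIsometry (n : ℕ) (θ : ℝ) : Cn n ≃ₗᵢ[ℝ] Cn n where
  toFun v := Complex.exp (θ * Complex.I) • v
  invFun v := (Complex.exp (θ * Complex.I))⁻¹ • v
  map_add' v w := smul_add _ v w
  map_smul' c v := smul_comm _ c v
  left_inv v := inv_smul_smul₀ (Complex.exp_ne_zero _) v
  right_inv v := smul_inv_smul₀ (Complex.exp_ne_zero _) v
  norm_map' v := by
    change ‖Complex.exp (θ * Complex.I) • v‖ = ‖v‖
    rw [norm_smul, Complex.norm_exp_ofReal_mul_I, one_mul]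

lemma lintegral_ball_smul_circle (δ θ : ℝ) {F : Cn n → ℝ≥0∞} (hF : Measurable F) (z : Cn n) :
    ∫⁻ v in Metric.ball 0 δ, F (z + Complex.exp (θ * Complex.I) • v) =
      ∫⁻ v in Metric.ball z δ, F v := by
  have h := ((measurePreserving_add_left volume z).comp
    (rotationIsometry n θ).measurePreserving).setLIntegral_comp_preimage
      (measurableSet_ball (x := z) (ε := δ)) hF
  rw [← h]
  have hs : (fun v => z + v) ∘ rotationIsometry n θ ⁻¹' Metric.ball z δ = Metric.ball 0 δ := by
    ext v
    simp
  rw [hs]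
  rfl

/-- The mean value inequality over balls. -/
lemma volume_ball_mul_enorm_le {g : Cn n → ℂ} (hg : Differentiable ℂ g) (z : Cn n) (δ : ℝ) :
    volume (Metric.ball (0 : Cn n) δ) * ‖g z‖ₑ ≤ ∫⁻ w in Metric.ball z δ, ‖g w‖ₑ := by
  have hπ := Real.pi_pos
  have hc := hg.continuous
  have h2 : ENNReal.ofReal (2 * Real.pi) ≠ 0 := by simp [hπ]
  have h : ENNReal.ofReal (2 * Real.pi) * (volume (Metric.ball (0 : Cn n) δ) * ‖g z‖ₑ) ≤
      ENNReal.ofReal (2 * Real.pi) * ∫⁻ w in Metric.ball z δ, ‖g w‖ₑ := by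
    -- The circle inequality is integrated over all directions `v` in the ball. After Tonelli,
    -- rotation invariance of the ball and of the volume makes the inner integral independent of
    -- `θ`, so no polar coordinates are needed.
    calc _ = ∫⁻ v in Metric.ball (0 : Cn n) δ, ENNReal.ofReal (2 * Real.pi) * ‖g z‖ₑ := by
          rw [setLIntegral_const]; ring
      _ ≤ ∫⁻ v in Metric.ball (0 : Cn n) δ, ∫⁻ θ in Set.Ioc 0 (2 * Real.pi),
            ‖g (z + Complex.exp (θ * Complex.I) • v)‖ₑ :=
          lintegral_mono fun v => enorm_le_lintegral_circle hg z v
      _ = ∫⁻ θ in Set.Ioc 0 (2 * Real.pi), ∫⁻ v in Metric.ball (0 : Cn n) δ,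
            ‖g (z + Complex.exp (θ * Complex.I) • v)‖ₑ := by
          apply lintegral_lintegral_swap
          apply Measurable.aemeasurable
          have : Continuous (Function.uncurry fun (v : Cn n) (θ : ℝ) =>
              g (z + Complex.exp (θ * Complex.I) • v)) := by
            unfold Function.uncurry
            fun_prop
          exact this.measurable.enorm
      _ = ∫⁻ θ in Set.Ioc 0 (2 * Real.pi), ∫⁻ w in Metric.ball z δ, ‖g w‖ₑ := by
          congr 1 with θ
          exact lintegral_ball_smul_circle δ θ hc.measurable.enorm z
      _ = _ := by rw [setLIntegral_const, Real.volume_Ioc, sub_zero, mul_comm]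
  exact (ENNReal.mul_le_mul_iff_right h2 ENNReal.ofReal_ne_top).1 h

/-- The submean value property of the weighted modulus of an entire function. -/
lemma weightedAbs_le_lintegral_ball {α : ℝ} (hα : 0 ≤ α) {f : Cn n → ℂ} (hf : Differentiable ℂ f)
    (z : Cn n) {δ : ℝ} (hδ : 0 < δ) :
    weightedAbs α f z ≤ ENNReal.ofReal (Real.exp (α / 2 * δ ^ 2)) *
      (volume (Metric.ball (0 : Cn n) δ))⁻¹ * ∫⁻ w in Metric.ball z δ, weightedAbs α f w := by
  set V := volume (Metric.ball (0 : Cn n) δ)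
  have hV0 : V ≠ 0 := (Metric.measure_ball_pos _ _ hδ).ne'
  have hVt : V ≠ ∞ := measure_ball_lt_top.ne
  -- The holomorphic factor recentres the weight at `z`: `|g(w)|` is the weighted modulus times `exp
  -- (α/2 |w - z|²)`, a factor equal to 1 at `z` and at most `exp (α/2 δ²)` on the ball.
  let g : Cn n → ℂ := fun w =>
    f w * Complex.exp (((-α : ℝ) : ℂ) * inner ℂ z w + ((α / 2 * ‖z‖ ^ 2 : ℝ) : ℂ))
  have hg : Differentiable ℂ g := by
    have : Differentiable ℂ fun w : Cn n => (inner ℂ z w : ℂ) := (innerSL ℂ z).differentiable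
    fun_prop
  have hgn (w : Cn n) : ‖g w‖ₑ =
      weightedAbs α f w * ENNReal.ofReal (Real.exp (α / 2 * ‖w - z‖ ^ 2)) := by
    simp only [g]
    rw [enorm_mul, enorm_cexp, weightedAbs, mul_assoc, ofReal_exp_mul_ofReal_exp,
      norm_sub_sq_complex, Complex.add_re, Complex.re_ofReal_mul, Complex.ofReal_re]
    congr 3
    ring
  have hz : weightedAbs α f z = ‖g z‖ₑ := by simp [hgn]
  have key := volume_ball_mul_enorm_le hg z δ
  rw [← hz] at key
  have h2 : ∫⁻ w in Metric.ball z δ, ‖g w‖ₑ ≤ ∫⁻ w in Metric.ball z δ,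
      ENNReal.ofReal (Real.exp (α / 2 * δ ^ 2)) * weightedAbs α f w := by
    refine setLIntegral_mono' measurableSet_ball fun w hw => ?_
    rw [hgn, mul_comm]
    gcongr
    exact (mem_ball_iff_norm.1 hw).le
  rw [lintegral_const_mul' _ _ ENNReal.ofReal_ne_top] at h2
  calc weightedAbs α f z = V⁻¹ * (V * weightedAbs α f z) := by
        rw [← mul_assoc, ENNReal.inv_mul_cancel hV0 hVt, one_mul]
    _ ≤ V⁻¹ * (ENNReal.ofReal (Real.exp (α / 2 * δ ^ 2)) *
          ∫⁻ w in Metric.ball z δ, weightedAbs α f w) := mul_le_mul_right (key.trans h2) _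
    _ = _ := by ring

lemma fockNorm_eq {α p : ℝ} (hp : 0 < p) (f : Cn n → ℂ) :
    fockNorm α p f = ENNReal.ofReal ((α * p / (2 * Real.pi)) ^ n) ^ (1 / p) *
      (∫⁻ z, weightedAbs α f z ^ p) ^ (1 / p) := by
  rw [fockNorm, weightedIntegral_eq hp.le, ENNReal.mul_rpow_of_nonneg _ _ (by positivity)]

/-- Point evaluations are bounded on Fock spaces, uniformly with respect to the weight. -/
lemma exists_weightedAbs_le_fockNorm (n : ℕ) {α p : ℝ} (hα : 0 < α) (hp : 1 ≤ p) :
    ∃ C : ℝ≥0, ∀ f : Cn n → ℂ, Differentiable ℂ f → ∀ z, weightedAbs α f z ≤ C * fockNorm α p f := by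
  have hp0 : 0 < p := by linarith
  have hπ := Real.pi_pos
  set V := volume (Metric.ball (0 : Cn n) 1) with hV
  have hV0 : V ≠ 0 := (Metric.measure_ball_pos _ _ one_pos).ne'
  have hVt : V ≠ ∞ := measure_ball_lt_top.ne
  set N := ENNReal.ofReal ((α * p / (2 * Real.pi)) ^ n) ^ (1 / p) with hN
  have hNt : N ≠ ∞ := ENNReal.rpow_ne_top_of_nonneg (by positivity) ENNReal.ofReal_ne_top
  have hN0 : N ≠ 0 := by
    have : 0 < N := ENNReal.rpow_pos (ENNReal.ofReal_pos.2 (by positivity)) ENNReal.ofReal_ne_top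
    exact this.ne'
  set A := ENNReal.ofReal (Real.exp (α / 2 * 1 ^ 2)) * V⁻¹ with hA
  have hAt : A ≠ ∞ := ENNReal.mul_ne_top ENNReal.ofReal_ne_top (ENNReal.inv_ne_top.2 hV0)
  set B := V ^ (1 / 1 - 1 / p) with hB
  have hBt : B ≠ ∞ := ENNReal.rpow_ne_top_of_nonneg (by
    rw [sub_nonneg]; exact one_div_le_one_div_of_le one_pos hp) hVt
  refine ⟨(A * B * N⁻¹).toNNReal, fun f hf z => ?_⟩
  rw [ENNReal.coe_toNNReal (by finiteness), fockNorm_eq hp0]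
  have h1 : ∫⁻ w in Metric.ball z 1, weightedAbs α f w ≤
      (∫⁻ w, weightedAbs α f w ^ p) ^ (1 / p) * B := by
    -- Hölder on the unit ball, which costs the factor `V ^ (1 - 1/p)`.
    have := eLpNorm'_le_eLpNorm'_mul_rpow_measure_univ (μ := volume.restrict (Metric.ball z 1))
      (f := weightedAbs α f) one_pos hp (measurable_weightedAbs α hf.continuous).aestronglyMeasurable
    simp only [eLpNorm', enorm_eq_self, ENNReal.rpow_one, Measure.restrict_apply_univ,
      div_one, Measure.addHaar_ball_center volume z 1, ← hV] at this
    refine this.trans ?_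
    rw [hB, div_one]
    gcongr
    exact Measure.restrict_le_self
  calc weightedAbs α f z ≤ A * ∫⁻ w in Metric.ball z 1, weightedAbs α f w :=
        weightedAbs_le_lintegral_ball hα.le hf z one_pos
    _ ≤ A * ((∫⁻ w, weightedAbs α f w ^ p) ^ (1 / p) * B) := by gcongr
    _ = A * B * (N⁻¹ * N) * (∫⁻ w, weightedAbs α f w ^ p) ^ (1 / p) := by
        rw [ENNReal.inv_mul_cancel hN0 hNt]; ring
    _ = _ := by ring

-- Averages, Gaussian transforms and the Carleson embedding

/-- Tonelli, with the symmetry `u ∈ D(z, δ) ↔ z ∈ D(u, δ)`. -/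
lemma lintegral_lintegral_ball_le (μ : Measure (Cn n)) [SFinite μ] {h : Cn n → ℝ≥0∞}
    (hh : Measurable h) (δ : ℝ) :
    ∫⁻ z, (∫⁻ u in Metric.ball z δ, h u) ∂μ ≤ (⨆ u, averaging δ μ u) * ∫⁻ u, h u := by
  have hm : MeasurableSet {x : Cn n × Cn n | dist x.2 x.1 < δ} :=
    (isOpen_lt (by fun_prop) (by fun_prop)).measurableSet
  calc ∫⁻ z, (∫⁻ u in Metric.ball z δ, h u) ∂μ
      = ∫⁻ z, (∫⁻ u, (Metric.ball z δ).indicator h u) ∂μ := by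
        congr 1 with z
        rw [lintegral_indicator measurableSet_ball]
    _ = ∫⁻ u, ∫⁻ z, (Metric.ball z δ).indicator h u ∂μ := by
        apply lintegral_lintegral_swap
        exact ((hh.comp measurable_snd).indicator hm).aemeasurable
    _ = ∫⁻ u, h u * averaging δ μ u := by
        congr 1 with u
        have : (fun z => (Metric.ball z δ).indicator h u) =
            (Metric.ball u δ).indicator fun _ => h u := by
          ext z
          simp only [Set.indicator, Metric.mem_ball, dist_comm]
        rw [this, lintegral_indicator_const measurableSet_ball, averaging]
    _ ≤ ∫⁻ u, h u * ⨆ u, averaging δ μ u :=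
        lintegral_mono fun u => mul_le_mul_right (le_iSup (averaging δ μ) u) _
    _ = _ := by rw [lintegral_mul_const _ hh, mul_comm]

lemma averaging_le_gaussianTransform {c : ℝ} (hc : 0 ≤ c) (δ : ℝ) (μ : Measure (Cn n))
    (w : Cn n) :
    averaging δ μ w ≤ ENNReal.ofReal (Real.exp (c * δ ^ 2)) * gaussianTransform c μ w := by
  rw [averaging, gaussianTransform, ← lintegral_const_mul' _ _ ENNReal.ofReal_ne_top,
    ← lintegral_indicator_one measurableSet_ball]
  refine lintegral_mono fun z => ?_
  by_cases hz : z ∈ Metric.ball w δ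
  · rw [Set.indicator_of_mem hz, ofReal_exp_mul_ofReal_exp, Pi.one_apply, ← ENNReal.ofReal_one]
    refine ENNReal.ofReal_le_ofReal (Real.one_le_exp ?_)
    have h1 : ‖z - w‖ ^ 2 ≤ δ ^ 2 := by
      have := (mem_ball_iff_norm.1 hz).le
      gcongr
    nlinarith
  · simp [hz]

/-- For `|u - z| < δ` one has `|u - w|² ≤ 2δ² + 2|z - w|²`, so the Gaussian at `z` is at most a
constant times the mean over `D(z, δ)` of the wider Gaussian with `c / 2`. Tonelli then leaves S
times a Lebesgue integral that does not depend on `w`. -/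
lemma exists_gaussianTransform_le_averaging (n : ℕ) {c δ : ℝ} (hc : 0 < c) (hδ : 0 < δ) :
    ∃ C : ℝ≥0, ∀ μ : Measure (Cn n), SFinite μ → ∀ w,
      gaussianTransform c μ w ≤ C * ⨆ u, averaging δ μ u := by
  set V := volume (Metric.ball (0 : Cn n) δ) with hV
  have hV0 : V ≠ 0 := (Metric.measure_ball_pos _ _ hδ).ne'
  have hVt : V ≠ ∞ := measure_ball_lt_top.ne
  set A := ENNReal.ofReal (Real.exp (c * δ ^ 2)) with hA
  set G := ENNReal.ofReal ((Real.pi / (c / 2)) ^ n) with hG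
  refine ⟨(V⁻¹ * A * G).toNNReal, fun μ hμ w => ?_⟩
  rw [ENNReal.coe_toNNReal (by finiteness)]
  let h : Cn n → ℝ≥0∞ := fun u => ENNReal.ofReal (Real.exp (-(c / 2) * ‖u - w‖ ^ 2))
  have hh : Measurable h := by fun_prop
  have hG' : ∫⁻ u, h u = G := gaussianTransform_volume (by positivity) w
  have hpt (z : Cn n) : ENNReal.ofReal (Real.exp (-c * ‖z - w‖ ^ 2)) ≤
      V⁻¹ * A * ∫⁻ u in Metric.ball z δ, h u := by
    calc ENNReal.ofReal (Real.exp (-c * ‖z - w‖ ^ 2))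
        = V⁻¹ * ∫⁻ u in Metric.ball z δ, ENNReal.ofReal (Real.exp (-c * ‖z - w‖ ^ 2)) := by
          rw [setLIntegral_const, Measure.addHaar_ball_center volume z δ, ← hV, mul_left_comm,
            ENNReal.inv_mul_cancel hV0 hVt, mul_one]
      _ ≤ V⁻¹ * ∫⁻ u in Metric.ball z δ, A * h u := by
          refine mul_le_mul_right (setLIntegral_mono' measurableSet_ball fun u hu => ?_) _
          rw [hA, ofReal_exp_mul_ofReal_exp]
          refine ENNReal.ofReal_le_ofReal (Real.exp_le_exp.2 ?_)
          have h1 : ‖u - w‖ ≤ δ + ‖z - w‖ := by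
            have := norm_add_le (u - z) (z - w)
            rw [sub_add_sub_cancel] at this
            linarith [(mem_ball_iff_norm.1 hu).le]
          have h2 : ‖u - w‖ ^ 2 ≤ 2 * δ ^ 2 + 2 * ‖z - w‖ ^ 2 := by
            nlinarith [norm_nonneg (u - w), sq_nonneg (δ - ‖z - w‖)]
          nlinarith
      _ = _ := by rw [lintegral_const_mul _ hh, mul_assoc]
  calc gaussianTransform c μ w ≤ ∫⁻ z, (V⁻¹ * A * ∫⁻ u in Metric.ball z δ, h u) ∂μ :=
        lintegral_mono hpt
    _ = V⁻¹ * A * ∫⁻ z, (∫⁻ u in Metric.ball z δ, h u) ∂μ :=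
        lintegral_const_mul' _ _ (by finiteness)
    _ ≤ V⁻¹ * A * ((⨆ u, averaging δ μ u) * ∫⁻ u, h u) := by
        gcongr
        exact lintegral_lintegral_ball_le μ hh δ
    _ = _ := by rw [hG']; ring

/-- The Gaussian transform with `c = 1` lies between the two averages and replaces a covering
argument. -/
lemma exists_iSup_averaging_le (n : ℕ) (δ : ℝ) {ε : ℝ} (hε : 0 < ε) :
    ∃ C : ℝ≥0, ∀ μ : Measure (Cn n), SFinite μ →
      ⨆ u, averaging δ μ u ≤ C * ⨆ u, averaging ε μ u := by
  obtain ⟨C, hC⟩ := exists_gaussianTransform_le_averaging n one_pos hε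
  refine ⟨(ENNReal.ofReal (Real.exp (1 * δ ^ 2))).toNNReal * C, fun μ hμ => iSup_le fun u => ?_⟩
  rw [ENNReal.coe_mul, ENNReal.coe_toNNReal ENNReal.ofReal_ne_top, mul_assoc]
  exact (averaging_le_gaussianTransform zero_le_one δ μ u).trans (mul_le_mul_right (hC μ hμ u) _)

/-- The Carleson embedding of `F^1_α` for measures with bounded averages. -/
lemma exists_weightedIntegral_le_averaging (n : ℕ) {α q δ : ℝ} (hα : 0 < α) (hq : 1 ≤ q)
    (hδ : 0 < δ) :
    ∃ C : ℝ≥0, ∀ μ : Measure (Cn n), SFinite μ → ∀ f ∈ fockSpace n α 1,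
      weightedIntegral α q μ f ≤ C * (⨆ u, averaging δ μ u) * fockNorm α 1 f ^ q := by
  obtain ⟨P, hP⟩ := exists_weightedAbs_le_fockNorm n hα le_rfl
  have hπ := Real.pi_pos
  set V := volume (Metric.ball (0 : Cn n) δ) with hV
  have hV0 : V ≠ 0 := (Metric.measure_ball_pos _ _ hδ).ne'
  set A := ENNReal.ofReal (Real.exp (α / 2 * δ ^ 2)) * V⁻¹ with hA
  have hAt : A ≠ ∞ := ENNReal.mul_ne_top ENNReal.ofReal_ne_top (ENNReal.inv_ne_top.2 hV0)
  set N := ENNReal.ofReal ((α * 1 / (2 * Real.pi)) ^ n) with hN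
  have hN0 : N ≠ 0 := (ENNReal.ofReal_pos.2 (by positivity)).ne'
  have hNt : N ≠ ∞ := ENNReal.ofReal_ne_top
  have hPt : (P : ℝ≥0∞) ^ (q - 1) ≠ ∞ :=
    ENNReal.rpow_ne_top_of_nonneg (by linarith) ENNReal.coe_ne_top
  refine ⟨((P : ℝ≥0∞) ^ (q - 1) * A * N⁻¹).toNNReal, fun μ hμ f hf => ?_⟩
  rw [ENNReal.coe_toNNReal (by finiteness), weightedIntegral_eq (by linarith)]
  set F := fockNorm α 1 f with hF
  have hFt : F ≠ ∞ := hf.2.ne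
  have hI : ∫⁻ z, weightedAbs α f z = N⁻¹ * F := by
    rw [hF, fockNorm_eq one_pos]
    simp only [ENNReal.rpow_one, div_one]
    rw [← mul_assoc, ENNReal.inv_mul_cancel hN0 hNt, one_mul]
  have hpow (x : ℝ≥0∞) : x ^ q = x ^ (q - 1) * x := by
    conv_rhs => rw [← ENNReal.rpow_one x, ← ENNReal.rpow_mul, one_mul]
    rw [← ENNReal.rpow_add_of_nonneg _ _ (by linarith) zero_le_one]
    ring_nf
  -- Of the `q` powers, `q - 1` are absorbed by the point evaluation bound; the remaining one is
  -- treated by the submean value property and Tonelli.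
  calc ∫⁻ z, weightedAbs α f z ^ q ∂μ
      ≤ ∫⁻ z, (P * F) ^ (q - 1) * (A * ∫⁻ u in Metric.ball z δ, weightedAbs α f u) ∂μ := by
        refine lintegral_mono fun z => ?_
        rw [hpow]
        exact mul_le_mul' (ENNReal.rpow_le_rpow (hP f hf.1 z) (by linarith))
          (weightedAbs_le_lintegral_ball hα.le hf.1 z hδ)
    _ = (P * F) ^ (q - 1) * (A * ∫⁻ z, (∫⁻ u in Metric.ball z δ, weightedAbs α f u) ∂μ) := by
        rw [lintegral_const_mul' _ _ (ENNReal.rpow_ne_top_of_nonneg (by linarith) (by finiteness)),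
          lintegral_const_mul' _ _ hAt]
    _ ≤ (P * F) ^ (q - 1) * (A * ((⨆ u, averaging δ μ u) * ∫⁻ u, weightedAbs α f u)) := by
        gcongr
        exact lintegral_lintegral_ball_le μ (measurable_weightedAbs α hf.1.continuous) δ
    _ = _ := by
        rw [hI, hpow F, ENNReal.mul_rpow_of_nonneg _ _ (by linarith)]
        ring

-- Toeplitz operators: pointwise bounds and holomorphy

/-- Half of `exp (-α |w|²)` weights `f`; the other half completes the square with the kernel. The
leftover `exp (α/2 |z|²)` is cancelled by the weight of `F^∞_α`. -/
lemma enorm_toeplitzIntegrand (α : ℝ) (f : Cn n → ℂ) (z w : Cn n) :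
    ‖toeplitzIntegrand α f z w‖ₑ = weightedAbs α f w *
      (ENNReal.ofReal (Real.exp (-(α / 2) * ‖w - z‖ ^ 2)) *
        ENNReal.ofReal (Real.exp (α / 2 * ‖z‖ ^ 2))) := by
  rw [toeplitzIntegrand, enorm_mul, enorm_mul, fockKernel, enorm_cexp, Complex.re_ofReal_mul,
    ← ofReal_norm (((Real.exp (-α * ‖w‖ ^ 2) : ℝ) : ℂ)), Complex.norm_real, Real.norm_eq_abs,
    abs_of_pos (Real.exp_pos _), weightedAbs, mul_comm (ENNReal.ofReal _) ‖f w‖ₑ, mul_assoc,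
    mul_assoc, ofReal_exp_mul_ofReal_exp, ofReal_exp_mul_ofReal_exp, ofReal_exp_mul_ofReal_exp,
    norm_sub_sq_complex,
    show (inner ℂ w z : ℂ).re = (inner ℂ z w : ℂ).re from inner_re_symm (𝕜 := ℂ) w z]
  congr 3
  ring

lemma continuous_toeplitzIntegrand (α : ℝ) {f : Cn n → ℂ} (hf : Continuous f) (z : Cn n) :
    Continuous (toeplitzIntegrand α f z) := by
  unfold toeplitzIntegrand fockKernel
  fun_prop

lemma lintegral_enorm_toeplitzIntegrand_le (α : ℝ) {f : Cn n → ℂ} {M : ℝ≥0∞} (hM : M ≠ ∞)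
    (hf : ∀ w, weightedAbs α f w ≤ M) (μ : Measure (Cn n)) (z : Cn n) :
    ∫⁻ w, ‖toeplitzIntegrand α f z w‖ₑ ∂μ ≤
      M * gaussianTransform (α / 2) μ z * ENNReal.ofReal (Real.exp (α / 2 * ‖z‖ ^ 2)) := by
  rw [gaussianTransform, ← lintegral_const_mul' _ _ hM,
    ← lintegral_mul_const' _ _ ENNReal.ofReal_ne_top]
  refine lintegral_mono fun w => ?_
  rw [enorm_toeplitzIntegrand, mul_assoc]
  gcongr
  exact hf w

lemma weightedAbs_toeplitz_le (α : ℝ) {f : Cn n → ℂ} {M : ℝ≥0∞} (hM : M ≠ ∞)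
    (hf : ∀ w, weightedAbs α f w ≤ M) (μ : Measure (Cn n)) (z : Cn n) :
    weightedAbs α (toeplitz α μ f) z ≤ M * gaussianTransform (α / 2) μ z := by
  calc weightedAbs α (toeplitz α μ f) z
      ≤ M * gaussianTransform (α / 2) μ z * ENNReal.ofReal (Real.exp (α / 2 * ‖z‖ ^ 2)) *
          ENNReal.ofReal (Real.exp (-(α / 2) * ‖z‖ ^ 2)) := by
        rw [weightedAbs]
        gcongr
        exact (enorm_integral_le_lintegral_enorm _).trans
          (lintegral_enorm_toeplitzIntegrand_le α hM hf μ z)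
    _ = _ := by
        rw [mul_assoc, ofReal_exp_mul_ofReal_exp, neg_mul, add_neg_cancel, Real.exp_zero,
          ENNReal.ofReal_one, mul_one]

lemma integrable_toeplitzIntegrand (α : ℝ) {f : Cn n → ℂ} (hc : Continuous f) {M : ℝ≥0∞}
    (hM : M ≠ ∞) (hf : ∀ w, weightedAbs α f w ≤ M) {μ : Measure (Cn n)} {z : Cn n}
    (hμ : gaussianTransform (α / 2) μ z ≠ ∞) : Integrable (toeplitzIntegrand α f z) μ := by
  refine ⟨(continuous_toeplitzIntegrand α hc z).aestronglyMeasurable, ?_⟩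
  refine (lintegral_enorm_toeplitzIntegrand_le α hM hf μ z).trans_lt ?_
  finiteness

lemma norm_le_of_weightedAbs_le {α : ℝ} {f : Cn n → ℂ} {M : ℝ≥0} {w : Cn n}
    (hf : weightedAbs α f w ≤ M) : ‖f w‖ ≤ M * Real.exp (α / 2 * ‖w‖ ^ 2) := by
  have h : ‖f w‖ * Real.exp (-(α / 2) * ‖w‖ ^ 2) ≤ M := by
    rw [weightedAbs, ← ofReal_norm, ← ENNReal.ofReal_mul (norm_nonneg _),
      ← ENNReal.ofReal_coe_nnreal] at hf
    exact (ENNReal.ofReal_le_ofReal_iff M.2).1 hf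
  calc ‖f w‖ = ‖f w‖ * Real.exp (-(α / 2) * ‖w‖ ^ 2) * Real.exp (α / 2 * ‖w‖ ^ 2) := by
        rw [mul_assoc, ← Real.exp_add, neg_mul, neg_add_cancel, Real.exp_zero, mul_one]
    _ ≤ _ := by gcongr

/-- `T_μ f` is entire when `f` is in `F^∞_α` and the averages of `μ` are bounded. -/
lemma differentiable_toeplitz {α : ℝ} (hα : 0 < α) {f : Cn n → ℂ} (hc : Continuous f) {M : ℝ≥0}
    (hf : ∀ w, weightedAbs α f w ≤ M) {μ : Measure (Cn n)}
    (hμ : ∀ c, 0 < c → ∀ w, gaussianTransform c μ w ≠ ∞) :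
    Differentiable ℂ (toeplitz α μ f) := by
  intro z₀
  let F' : Cn n → Cn n → Cn n →L[ℂ] ℂ := fun z w =>
    toeplitzIntegrand α f z w • ((α : ℂ) • innerSL ℂ w)
  -- `a` collects the terms linear in `|w|` of the exponent: `α (|z₀| + 1)` from the kernel with `z`
  -- in the unit ball about `z₀`, and 1 from `|w| ≤ exp |w|` in the derivative. Completing the
  -- square gives `a|w| - α/2 |w|² ≤ a²/α - α/4 |w|²`.
  set a := 1 + α * (‖z₀‖ + 1) with ha
  let bound : Cn n → ℝ := fun w =>
    α * M * Real.exp (a ^ 2 / α) * Real.exp (-(α / 4) * ‖w - 0‖ ^ 2)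
  have hb : Integrable bound μ := by
    refine Integrable.const_mul ⟨by fun_prop, ?_⟩ _
    have := hμ (α / 4) (by positivity) 0
    rw [gaussianTransform] at this
    rw [HasFiniteIntegral]
    simp only [Real.enorm_eq_ofReal (Real.exp_pos _).le]
    exact this.lt_top
  have hderiv (w z : Cn n) : HasFDerivAt (fun z => toeplitzIntegrand α f z w) (F' z w) z := by
    have h1 : HasFDerivAt (fun z : Cn n => (α : ℂ) * inner ℂ w z) ((α : ℂ) • innerSL ℂ w) z :=
      (innerSL ℂ w).hasFDerivAt.const_mul (α : ℂ)
    have h2 := (h1.cexp.mul_const (f w)).mul_const ((Real.exp (-α * ‖w‖ ^ 2) : ℝ) : ℂ)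
    refine h2.congr_fderiv ?_
    ext v
    simp only [F', toeplitzIntegrand, fockKernel, _root_.smul_apply, smul_eq_mul]
    ring
  refine (hasFDerivAt_integral_of_dominated_of_fderiv_le (F := toeplitzIntegrand α f) (F' := F')
    (bound := bound) (Metric.ball_mem_nhds z₀ one_pos) ?_ ?_ ?_ ?_ hb ?_).differentiableAt
  · exact Eventually.of_forall fun z => (continuous_toeplitzIntegrand α hc z).aestronglyMeasurable
  · exact integrable_toeplitzIntegrand α hc ENNReal.coe_ne_top hf (hμ _ (by positivity) _)
  · have : Continuous (F' z₀) :=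
      (continuous_toeplitzIntegrand α hc z₀).smul
        ((innerSL ℂ (E := Cn n)).continuous.const_smul (α : ℂ))
    exact this.aestronglyMeasurable
  · refine Eventually.of_forall fun w z hz => ?_
    have hz' : ‖z‖ ≤ ‖z₀‖ + 1 := by
      have := norm_le_norm_add_norm_sub' z z₀
      linarith [(mem_ball_iff_norm.1 hz).le]
    have h1 : ‖fockKernel α w z‖ ≤ Real.exp (α * ((‖z₀‖ + 1) * ‖w‖)) := by
      rw [fockKernel, Complex.norm_exp, Complex.re_ofReal_mul]
      gcongr
      calc (inner ℂ w z : ℂ).re ≤ ‖w‖ * ‖z‖ :=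
            (Complex.re_le_norm _).trans (norm_inner_le_norm _ _)
        _ ≤ _ := by rw [mul_comm]; gcongr
    have h3 : ‖w‖ ≤ Real.exp ‖w‖ := by linarith [Real.add_one_le_exp ‖w‖]
    calc ‖F' z w‖ = ‖fockKernel α w z‖ * ‖f w‖ * Real.exp (-α * ‖w‖ ^ 2) * (α * ‖w‖) := by
          simp only [F', toeplitzIntegrand, norm_smul, norm_mul, innerSL_apply_norm,
            Complex.norm_real, Real.norm_eq_abs, abs_of_pos hα, abs_of_pos (Real.exp_pos _)]
      _ ≤ Real.exp (α * ((‖z₀‖ + 1) * ‖w‖)) * (M * Real.exp (α / 2 * ‖w‖ ^ 2)) *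
            Real.exp (-α * ‖w‖ ^ 2) * (α * Real.exp ‖w‖) := by
          gcongr
          exact norm_le_of_weightedAbs_le (hf w)
      _ = α * M * Real.exp (α * ((‖z₀‖ + 1) * ‖w‖) + α / 2 * ‖w‖ ^ 2 + -α * ‖w‖ ^ 2 + ‖w‖) := by
          rw [Real.exp_add, Real.exp_add, Real.exp_add]; ring
      _ ≤ α * M * Real.exp (a ^ 2 / α + -(α / 4) * ‖w - 0‖ ^ 2) := by
          refine mul_le_mul_of_nonneg_left (Real.exp_le_exp.2 ?_) (by positivity)
          rw [sub_zero]
          have h4 : 0 ≤ (α / 2 * ‖w‖ - a) ^ 2 / α := by positivity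
          have h5 : (α / 2 * ‖w‖ - a) ^ 2 / α = α / 4 * ‖w‖ ^ 2 - a * ‖w‖ + a ^ 2 / α := by
            field_simp
            ring
          have h6 : a * ‖w‖ = ‖w‖ + α * ((‖z₀‖ + 1) * ‖w‖) := by rw [ha]; ring
          linarith
      _ = bound w := by rw [Real.exp_add, ← mul_assoc]
  · exact Eventually.of_forall fun w z _ => hderiv w z

-- Admissible measures and testing on kernels

lemma IsAdmissible.gaussianTransform_ne_top {α : ℝ} {μ : Measure (Cn n)} (h : IsAdmissible α μ)
    (z : Cn n) : gaussianTransform α μ z ≠ ∞ := by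
  have key (w : Cn n) : ENNReal.ofReal (Real.exp (-α * ‖w - z‖ ^ 2)) =
      ‖fockKernel α w z‖ₑ ^ 2 * ENNReal.ofReal (Real.exp (-α * ‖w‖ ^ 2)) *
        ENNReal.ofReal (Real.exp (-α * ‖z‖ ^ 2)) := by
    rw [fockKernel, enorm_cexp, sq (ENNReal.ofReal _), ofReal_exp_mul_ofReal_exp, ofReal_exp_mul_ofReal_exp,
      ofReal_exp_mul_ofReal_exp, norm_sub_sq_complex, Complex.re_ofReal_mul,
      show (inner ℂ w z : ℂ).re = (inner ℂ z w : ℂ).re from inner_re_symm (𝕜 := ℂ) w z]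
    congr 2
    ring
  have := (h z).ne
  simp only [gaussianTransform, key]
  rw [lintegral_mul_const' _ _ ENNReal.ofReal_ne_top]
  finiteness

/-- Unit balls have finite measure, being dominated by the Gaussian transform. This licenses every
use of Tonelli. -/
lemma IsAdmissible.sFinite {α : ℝ} (hα : 0 ≤ α) {μ : Measure (Cn n)} (h : IsAdmissible α μ) :
    SFinite μ := by
  have : IsLocallyFiniteMeasure μ := ⟨fun x => ⟨Metric.ball x 1, Metric.ball_mem_nhds x one_pos,
    (averaging_le_gaussianTransform hα 1 μ x).trans_lt
      (ENNReal.mul_lt_top ENNReal.ofReal_lt_top (h.gaussianTransform_ne_top x).lt_top)⟩⟩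
  infer_instance

/-- The phases of `K_v(w)` and `k_w(v)` are conjugate, so the integrand is positive and `T_μ k_w
(w)` suffers no cancellation. -/
lemma toeplitzIntegrand_normalizedFockKernel_self (α : ℝ) (w v : Cn n) :
    toeplitzIntegrand α (normalizedFockKernel α w) w v =
      ((Real.exp (-α * ‖v - w‖ ^ 2) * Real.exp (α / 2 * ‖w‖ ^ 2) : ℝ) : ℂ) := by
  have h : (inner ℂ v w : ℂ) + inner ℂ w v = ((2 * (inner ℂ w v : ℂ).re : ℝ) : ℂ) := by
    rw [← inner_conj_symm v w, add_comm, Complex.add_conj]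
  rw [toeplitzIntegrand, normalizedFockKernel, fockKernel, ← Real.exp_add, Complex.ofReal_exp,
    Complex.ofReal_exp, ← Complex.exp_add, ← Complex.exp_add, norm_sub_sq_complex]
  congr 1
  have h2 : (α : ℂ) * inner ℂ v w + (α * inner ℂ w v - ((α * ‖w‖ ^ 2 / 2 : ℝ) : ℂ)) =
      ((α * (2 * (inner ℂ w v : ℂ).re) - α * ‖w‖ ^ 2 / 2 : ℝ) : ℂ) := by
    rw [Complex.ofReal_sub, Complex.ofReal_mul, ← h]
    ring
  rw [h2, ← Complex.ofReal_add]
  congr 1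
  ring

lemma weightedAbs_toeplitz_normalizedFockKernel_self (α : ℝ) (μ : Measure (Cn n)) (w : Cn n)
    (h : gaussianTransform α μ w ≠ ∞) :
    weightedAbs α (toeplitz α μ (normalizedFockKernel α w)) w = gaussianTransform α μ w := by
  have hi : Integrable (fun v => Real.exp (-α * ‖v - w‖ ^ 2)) μ := by
    refine ⟨by fun_prop, ?_⟩
    rw [HasFiniteIntegral]
    simp only [Real.enorm_eq_ofReal (Real.exp_pos _).le]
    exact h.lt_top
  rw [weightedAbs, toeplitz]
  simp only [toeplitzIntegrand_normalizedFockKernel_self]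
  rw [integral_complex_ofReal, ← ofReal_norm, Complex.norm_real, integral_mul_const,
    Real.norm_eq_abs, abs_of_nonneg (mul_nonneg (integral_nonneg fun _ => (Real.exp_pos _).le)
      (Real.exp_pos _).le), ENNReal.ofReal_mul' (Real.exp_pos _).le,
    ofReal_integral_eq_lintegral_ofReal hi (Eventually.of_forall fun _ => (Real.exp_pos _).le),
    mul_assoc, ofReal_exp_mul_ofReal_exp, neg_mul (α / 2), add_neg_cancel, Real.exp_zero,
    ENNReal.ofReal_one, mul_one, gaussianTransform]

/-- Up to a factor depending on `z`, the integrand is a product `ab` of Gaussians with constant `α /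
2`. By `ab ≤ a² + b²` it is dominated by Gaussians with constant `α`, which admissibility alone
makes integrable. -/
lemma IsAdmissible.normalizedFockKernel_mem_toeplitzDomain {α p : ℝ} (hα : 0 < α) (hp : 0 < p)
    {μ : Measure (Cn n)} (h : IsAdmissible α μ) (w : Cn n) :
    normalizedFockKernel α w ∈ toeplitzDomain α p μ := by
  refine ⟨normalizedFockKernel_mem_fockSpace hα hp w, fun z => ⟨(continuous_toeplitzIntegrand α
    (differentiable_normalizedFockKernel α w).continuous z).aestronglyMeasurable, ?_⟩⟩
  set E := ENNReal.ofReal (Real.exp (α / 2 * ‖z‖ ^ 2)) with hE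
  have hEt : E ≠ ∞ := ENNReal.ofReal_ne_top
  have hpt (v : Cn n) : ‖toeplitzIntegrand α (normalizedFockKernel α w) z v‖ₑ ≤
      (ENNReal.ofReal (Real.exp (-α * ‖v - w‖ ^ 2)) +
        ENNReal.ofReal (Real.exp (-α * ‖v - z‖ ^ 2))) * E := by
    rw [enorm_toeplitzIntegrand, weightedAbs_normalizedFockKernel, ← mul_assoc,
      ← ENNReal.ofReal_add (Real.exp_pos _).le (Real.exp_pos _).le,
      ← ENNReal.ofReal_mul (Real.exp_pos _).le]
    refine mul_le_mul_left (ENNReal.ofReal_le_ofReal ?_) _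
    have h1 (x : ℝ) : Real.exp (-α * x) = Real.exp (-(α / 2) * x) ^ 2 := by
      rw [← Real.exp_nat_mul]
      congr 1
      push_cast
      ring
    rw [h1, h1]
    set a := Real.exp (-(α / 2) * ‖v - w‖ ^ 2)
    set b := Real.exp (-(α / 2) * ‖v - z‖ ^ 2)
    nlinarith [sq_nonneg (a - b), sq_nonneg (a + b)]
  refine (lintegral_mono hpt).trans_lt ?_
  rw [lintegral_mul_const' _ _ hEt, lintegral_add_left (by fun_prop)]
  have h1 := h.gaussianTransform_ne_top w
  have h2 := h.gaussianTransform_ne_top z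
  unfold gaussianTransform at h1 h2
  finiteness

-- Essential suprema and lattices

/-- By continuity from below, a slightly smaller concentric ball already has measure above `c`, and
it lies in `D(w, δ)` for `w` near `z`. -/
lemma lowerSemicontinuous_averaging (δ : ℝ) (μ : Measure (Cn n)) :
    LowerSemicontinuous (averaging δ μ) := by
  intro z c hc
  have hU : Metric.ball z δ = ⋃ k : ℕ, Metric.ball z (δ - 1 / (k + 1)) := by
    ext w
    simp only [Metric.mem_ball, Set.mem_iUnion]
    constructor
    · intro h
      obtain ⟨k, hk⟩ := exists_nat_one_div_lt (sub_pos.2 h)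
      exact ⟨k, by linarith⟩
    · rintro ⟨k, hk⟩
      have : (0 : ℝ) < 1 / (k + 1) := by positivity
      linarith
  have hmono : Monotone fun k : ℕ => Metric.ball z (δ - 1 / ((k : ℝ) + 1)) := by
    intro j k hjk
    refine Metric.ball_subset_ball (sub_le_sub_left ?_ _)
    exact one_div_le_one_div_of_le (by positivity) (by gcongr)
  rw [averaging, hU, hmono.measure_iUnion, gt_iff_lt, lt_iSup_iff] at hc
  obtain ⟨k, hk⟩ := hc
  have hpos : (0 : ℝ) < 1 / (k + 1) := by positivity
  filter_upwards [Metric.ball_mem_nhds z hpos] with w hw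
  refine hk.trans_le (measure_mono (Metric.ball_subset_ball' ?_))
  rw [Metric.mem_ball, dist_comm] at hw
  linarith

/-- The set where the average exceeds its essential supremum is open by semicontinuity and null,
hence empty. -/
lemma eLpNorm_averaging (δ : ℝ) (μ : Measure (Cn n)) :
    eLpNorm (averaging δ μ) ∞ volume = ⨆ z, averaging δ μ z := by
  simp only [eLpNorm_exponent_top, eLpNormEssSup, enorm_eq_self]
  refine le_antisymm (essSup_le_of_ae_le _ (Eventually.of_forall fun z =>
    le_iSup (averaging δ μ) z)) (iSup_le fun z => ?_)
  by_contra! hz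
  have ho := (lowerSemicontinuous_averaging δ μ).isOpen_preimage
    (essSup (averaging δ μ) volume)
  have hpos := ho.measure_pos volume ⟨z, hz⟩
  have hnull : volume (averaging δ μ ⁻¹' Set.Ioi (essSup (averaging δ μ) volume)) = 0 := by
    have := ae_le_essSup (μ := volume) (f := averaging δ μ)
    simpa [ae_iff, Set.preimage] using this
  exact hpos.ne' hnull

lemma memLp_averaging_iff (δ : ℝ) (μ : Measure (Cn n)) :
    MemLp (averaging δ μ) ∞ volume ↔ ⨆ z, averaging δ μ z < ∞ := by
  rw [← eLpNorm_averaging]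
  exact ⟨fun h => h.2, fun h =>
    ⟨(lowerSemicontinuous_averaging δ μ).measurable.aestronglyMeasurable, h⟩⟩

lemma measurable_gaussianTransform (c : ℝ) (μ : Measure (Cn n)) [SFinite μ] :
    Measurable (gaussianTransform c μ) := by
  unfold gaussianTransform
  exact Measurable.lintegral_prod_left'
    (f := fun x : Cn n × Cn n => ENNReal.ofReal (Real.exp (-c * ‖x.1 - x.2‖ ^ 2))) (by fun_prop)

lemma eLpNorm_berezin_le {α t : ℝ} {μ : Measure (Cn n)} {B : ℝ≥0∞}
    (h : ∀ w, berezin α t μ w ≤ B) : eLpNorm (berezin α t μ) ∞ volume ≤ B := by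
  simp only [eLpNorm_exponent_top, eLpNormEssSup, enorm_eq_self]
  exact essSup_le_of_ae_le _ (Eventually.of_forall h)

lemma iSup_averaging_le_eLpNorm_berezin {α t : ℝ} (hα : 0 ≤ α) (ht : 0 ≤ t) (δ : ℝ)
    (μ : Measure (Cn n)) :
    ⨆ z, averaging δ μ z ≤ ENNReal.ofReal (Real.exp (t * α / 2 * δ ^ 2)) *
      eLpNorm (berezin α t μ) ∞ volume := by
  rw [← eLpNorm_averaging]
  simp only [eLpNorm_exponent_top, eLpNormEssSup, enorm_eq_self]
  refine essSup_le_of_ae_le _ ?_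
  filter_upwards [ae_le_essSup (μ := volume) (f := berezin α t μ)] with w hw
  refine (averaging_le_gaussianTransform (by positivity : 0 ≤ t * α / 2) δ μ w).trans ?_
  rw [← berezin_eq ht]
  gcongr

lemma iSup_averaging_le_iSup_lattice {r : ℝ} {z : ℕ → Cn n} (hz : IsHalfLattice r z)
    (μ : Measure (Cn n)) :
    ⨆ w, averaging (r / 2) μ w ≤ ⨆ k, averaging r μ (z k) := by
  refine iSup_le fun w => ?_
  have hw : w ∈ ⋃ k, Metric.ball (z k) (r / 2) := hz.1 ▸ Set.mem_univ w
  obtain ⟨k, hk⟩ := Set.mem_iUnion.1 hw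
  refine le_trans (measure_mono (Metric.ball_subset_ball' ?_))
    (le_iSup (fun k => averaging r μ (z k)) k)
  linarith [Metric.mem_ball.1 hk]

/-- Half-lattices exist: they enumerate maximal `r/2`-separated sets. -/
lemma exists_isHalfLattice (hn : 1 ≤ n) {r : ℝ} (hr : 0 < r) :
    ∃ z : ℕ → Cn n, IsHalfLattice r z := by
  obtain ⟨S, hS⟩ := zorn_subset {S : Set (Cn n) | S.Pairwise fun x y => r / 2 ≤ dist x y}
    fun c hc hchain => ⟨⋃₀ c, (Set.pairwise_sUnion hchain.directedOn).2 hc,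
      fun s hs => Set.subset_sUnion_of_mem hs⟩
  have hcover (w : Cn n) : ∃ x ∈ S, dist w x < r / 2 := by
    by_contra! hw
    have hwS : w ∈ S := by
      refine hS.2 (y := insert w S) ?_ (Set.subset_insert w S) (Set.mem_insert w S)
      refine hS.1.insert fun x hx _ => ⟨hw x hx, ?_⟩
      rw [dist_comm]
      exact hw x hx
    have := hw w hwS
    rw [dist_self] at this
    linarith
  have hdisj : S.PairwiseDisjoint fun x => Metric.ball x (r / 4) := by
    intro x hx y hy hxy
    refine Metric.ball_disjoint_ball ?_
    have : r / 2 ≤ dist x y := hS.1 hx hy hxy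
    linarith
  have hcount : S.Countable := hdisj.countable_of_isOpen (fun _ _ => Metric.isOpen_ball)
    fun x _ => ⟨x, Metric.mem_ball_self (by linarith)⟩
  -- A lattice is indexed by `ℕ`, so `S` must be infinite: finitely many balls cannot cover `ℂⁿ`
  -- once `n ≥ 1`.
  have hinf : S.Infinite := by
    intro hfin
    have : Nonempty (Fin n) := ⟨⟨0, hn⟩⟩
    have hb : Bornology.IsBounded (⋃ x ∈ S, Metric.ball x (r / 2)) :=
      (Bornology.isBounded_biUnion hfin).2 fun _ _ => Metric.isBounded_ball
    have hu : (⋃ x ∈ S, Metric.ball x (r / 2)) = Set.univ :=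
      Set.eq_univ_of_forall fun w => by simpa using hcover w
    exact NormedSpace.unbounded_univ ℝ (Cn n) (hu ▸ hb)
  have := hcount.to_subtype
  have := hinf.to_subtype
  obtain ⟨e⟩ := nonempty_equiv_of_countable (α := ℕ) (β := S)
  refine ⟨fun k => e k, Set.eq_univ_of_forall fun w => ?_, fun j k hjk => ?_⟩
  · obtain ⟨x, hx, hwx⟩ := hcover w
    exact Set.mem_iUnion.2 ⟨e.symm ⟨x, hx⟩, by simpa using hwx⟩
  · exact hdisj (e j).2 (e k).2 fun h => hjk (e.injective (Subtype.ext h))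

-- Comparison of all quantities with the averages

lemma IsAdmissible.gaussianTransform_le_fockSupNorm {α : ℝ} {μ : Measure (Cn n)}
    (h : IsAdmissible α μ) (w : Cn n) :
    gaussianTransform α μ w ≤ fockSupNorm α (toeplitz α μ (normalizedFockKernel α w)) := by
  rw [← weightedAbs_toeplitz_normalizedFockKernel_self α μ w (h.gaussianTransform_ne_top w)]
  exact le_iSup (weightedAbs α (toeplitz α μ (normalizedFockKernel α w))) w

lemma weightedIntegral_normalizedFockKernel {q : ℝ} (hq : 0 ≤ q) (α : ℝ) (μ : Measure (Cn n))
    (w : Cn n) :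
    weightedIntegral α q μ (normalizedFockKernel α w) = gaussianTransform (α * q / 2) μ w := by
  rw [weightedIntegral_eq hq, gaussianTransform]
  congr 1 with z
  rw [weightedAbs_normalizedFockKernel, ofReal_exp_rpow]
  congr 2
  ring

lemma iSup_averaging_le_of_gaussianTransform_le {c : ℝ} (hc : 0 ≤ c) (δ : ℝ) {μ : Measure (Cn n)}
    {B : ℝ≥0∞} (h : ∀ w, gaussianTransform c μ w ≤ B) :
    ⨆ z, averaging δ μ z ≤ ENNReal.ofReal (Real.exp (c * δ ^ 2)) * B :=
  iSup_le fun w => (averaging_le_gaussianTransform hc δ μ w).trans (mul_le_mul_right (h w) _)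

lemma exists_fockSupNorm_toeplitz_le (n : ℕ) {α p δ : ℝ} (hα : 0 < α) (hp : 1 ≤ p) (hδ : 0 < δ) :
    ∃ C : ℝ≥0, ∀ μ : Measure (Cn n), SFinite μ → ∀ f ∈ fockSpace n α p,
      fockSupNorm α (toeplitz α μ f) ≤ C * (⨆ u, averaging δ μ u) * fockNorm α p f := by
  obtain ⟨P, hP⟩ := exists_weightedAbs_le_fockNorm n hα hp
  obtain ⟨C, hC⟩ := exists_gaussianTransform_le_averaging n (half_pos hα) hδ
  refine ⟨P * C, fun μ hμ f hf => iSup_le fun z => ?_⟩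
  have hM : (P : ℝ≥0∞) * fockNorm α p f ≠ ∞ := ENNReal.mul_ne_top ENNReal.coe_ne_top hf.2.ne
  calc weightedAbs α (toeplitz α μ f) z
      ≤ P * fockNorm α p f * gaussianTransform (α / 2) μ z :=
        weightedAbs_toeplitz_le α hM (hP f hf.1) μ z
    _ ≤ P * fockNorm α p f * (C * ⨆ u, averaging δ μ u) := by gcongr; exact hC μ hμ z
    _ = _ := by push_cast; ring

/-- Bounded averages make `T_μ` everywhere defined and bounded. -/
lemma toeplitz_bounded_of_averaging {α p δ : ℝ} (hα : 0 < α) (hp : 1 ≤ p) (hδ : 0 < δ)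
    {μ : Measure (Cn n)} [SFinite μ] (hS : ⨆ u, averaging δ μ u < ∞) :
    toeplitzDomain α p μ = fockSpace n α p ∧ IsBoundedToeplitz α p μ := by
  obtain ⟨P, hP⟩ := exists_weightedAbs_le_fockNorm n hα hp
  obtain ⟨C, hC⟩ := exists_fockSupNorm_toeplitz_le n hα hp hδ
  have hg (c : ℝ) (hc : 0 < c) (w : Cn n) : gaussianTransform c μ w ≠ ∞ := by
    obtain ⟨D, hD⟩ := exists_gaussianTransform_le_averaging n hc hδ
    exact ((hD μ inferInstance w).trans_lt (ENNReal.mul_lt_top ENNReal.coe_lt_top hS)).ne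
  refine ⟨Set.Subset.antisymm (fun f hf => hf.1) fun f hf => ⟨hf, fun z => ?_⟩,
    (C * ⨆ u, averaging δ μ u).toNNReal, fun f hf => ?_⟩
  · exact integrable_toeplitzIntegrand α hf.1.continuous
      (ENNReal.mul_ne_top ENNReal.coe_ne_top hf.2.ne) (hP f hf.1) (hg _ (half_pos hα) z)
  · have hf := hf.1
    have hCt : (C : ℝ≥0∞) * ⨆ u, averaging δ μ u ≠ ∞ :=
      ENNReal.mul_ne_top ENNReal.coe_ne_top hS.ne
    have hle := hC μ inferInstance f hf
    rw [ENNReal.coe_toNNReal hCt]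
    have hM : (P : ℝ≥0∞) * fockNorm α p f ≠ ∞ := ENNReal.mul_ne_top ENNReal.coe_ne_top hf.2.ne
    refine ⟨⟨differentiable_toeplitz hα hf.1.continuous
      (M := (P * fockNorm α p f).toNNReal) (fun w => ?_) hg,
      hle.trans_lt (ENNReal.mul_lt_top hCt.lt_top hf.2)⟩, hle⟩
    rw [ENNReal.coe_toNNReal hM]
    exact hP f hf.1 w

/-- The operator norm, the embedding norm and the sup norms of the Berezin transform, of the averages
and of the lattice averages are all comparable with the supremum of the averages of `μ`. -/
lemma exists_quantities_comparable (n : ℕ) {α p : ℝ} (hα : 0 < α) (hp : 1 ≤ p) {δ t r : ℝ}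
    (hδ : 0 < δ) (ht : 0 < t) (hr : 0 < r) :
    ∃ C : ℝ≥0, ∀ μ : Measure (Cn n), IsAdmissible α μ → ∀ z : ℕ → Cn n, IsHalfLattice r z →
      ∀ a ∈ [toeplitzNorm α p μ, embeddingNorm α 1 1 μ, eLpNorm (berezin α t μ) ∞ volume,
        eLpNorm (averaging δ μ) ∞ volume, (⨆ k, averaging r μ (z k))],
        a ≤ C * (⨆ u, averaging δ μ u) ∧ (⨆ u, averaging δ μ u) ≤ C * a := by
  have hp0 : 0 < p := by linarith
  obtain ⟨C₁, h₁⟩ := exists_fockSupNorm_toeplitz_le n hα hp hδ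
  obtain ⟨C₂, h₂⟩ := exists_weightedIntegral_le_averaging n hα le_rfl hδ
  obtain ⟨C₃, h₃⟩ :=
    exists_gaussianTransform_le_averaging n (by positivity : 0 < t * α / 2) hδ
  -- Lattice averages lie between suprema over all centres, of radius `r` from above and `r / 2`
  -- from below; `C₄` and `C₅` convert these radii to and from `δ`.
  obtain ⟨C₄, h₄⟩ := exists_iSup_averaging_le n r hδ
  obtain ⟨C₅, h₅⟩ := exists_iSup_averaging_le n δ (half_pos hr)
  set E : ℝ → ℝ≥0 := fun c => (ENNReal.ofReal (Real.exp (c * δ ^ 2))).toNNReal with hE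
  have hE' (c : ℝ) : (E c : ℝ≥0∞) = ENNReal.ofReal (Real.exp (c * δ ^ 2)) :=
    ENNReal.coe_toNNReal ENNReal.ofReal_ne_top
  obtain ⟨C, hC⟩ : ∃ C : ℝ≥0, ∀ x ∈ ({1, C₁, C₂, C₃, C₄, C₅, E α, E (α * 1 / 2),
      E (t * α / 2)} : Finset ℝ≥0), x ≤ C := Finset.exists_le _
  simp only [Finset.mem_insert, Finset.mem_singleton, forall_eq_or_imp, forall_eq] at hC
  obtain ⟨c0, c1, c2, c3, c4, c5, c6, c7, c8⟩ := hC
  have up {x : ℝ≥0} (hx : x ≤ C) (y : ℝ≥0∞) : (x : ℝ≥0∞) * y ≤ C * y := by gcongr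
  refine ⟨C, fun μ hμ z hz => ?_⟩
  have hs := hμ.sFinite hα.le
  set S := ⨆ u, averaging δ μ u with hS
  simp only [List.forall_mem_cons, List.not_mem_nil, IsEmpty.forall_iff, implies_true, and_true]
  refine ⟨⟨?_, ?_⟩, ⟨?_, ?_⟩, ⟨?_, ?_⟩, ⟨?_, ?_⟩, ⟨?_, ?_⟩⟩
  · refine iSup₂_le fun f hf => ?_
    calc fockSupNorm α (toeplitz α μ f) ≤ C₁ * S * fockNorm α p f := h₁ μ hs f hf.1.1
      _ ≤ C₁ * S * 1 := by gcongr; exact hf.2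
      _ ≤ C * S := by rw [mul_one]; exact up c1 S
  · refine le_trans ?_ (up c6 _)
    rw [hE']
    refine iSup_averaging_le_of_gaussianTransform_le hα.le δ fun w => ?_
    refine (hμ.gaussianTransform_le_fockSupNorm w).trans ?_
    exact le_iSup₂_of_le (normalizedFockKernel α w)
      ⟨hμ.normalizedFockKernel_mem_toeplitzDomain hα hp0 w,
        (fockNorm_normalizedFockKernel hα hp0 w).le⟩ le_rfl
  · refine iSup₂_le fun f hf => ?_
    rw [div_one, ENNReal.rpow_one]
    calc weightedIntegral α 1 μ f ≤ C₂ * S * fockNorm α 1 f ^ (1 : ℝ) := h₂ μ hs f hf.1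
      _ ≤ C₂ * S * 1 := by rw [ENNReal.rpow_one]; gcongr; exact hf.2
      _ ≤ C * S := by rw [mul_one]; exact up c2 S
  · refine le_trans ?_ (up c7 _)
    rw [hE']
    refine iSup_averaging_le_of_gaussianTransform_le (by positivity) δ fun w => ?_
    rw [← weightedIntegral_normalizedFockKernel zero_le_one]
    refine le_iSup₂_of_le (normalizedFockKernel α w)
      ⟨normalizedFockKernel_mem_fockSpace hα one_pos w,
        (fockNorm_normalizedFockKernel hα one_pos w).le⟩ ?_
    rw [div_one, ENNReal.rpow_one]
  · refine (eLpNorm_berezin_le fun w => ?_).trans (up c3 S)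
    rw [berezin_eq ht.le]
    exact h₃ μ hs w
  · refine le_trans ?_ (up c8 _)
    rw [hE']
    exact iSup_averaging_le_eLpNorm_berezin hα.le ht.le δ μ
  · have := up c0 S
    rw [ENNReal.coe_one, one_mul] at this
    rwa [eLpNorm_averaging]
  · have := up c0 S
    rw [ENNReal.coe_one, one_mul] at this
    rwa [eLpNorm_averaging]
  · exact (iSup_le fun k => le_iSup (averaging r μ) (z k)).trans ((h₄ μ hs).trans (up c4 S))
  · refine ((h₅ μ hs).trans (up c5 _)).trans ?_
    gcongr
    exact iSup_averaging_le_iSup_lattice hz μ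

theorem corollary2p3 (n : ℕ) (hn : 1 ≤ n) (α : ℝ) (hα : 0 < α) (p : ℝ) (hp : 1 ≤ p) :
    (∀ μ : Measure (Cn n), IsAdmissible α μ →
      List.TFAE [
        IsBoundedToeplitz α p μ,
        toeplitzDomain α p μ = fockSpace n α p ∧ IsBoundedToeplitz α p μ,
        ∃ q, p ≤ q ∧ IsFockCarleson α 1 q μ,
        ∀ q, p ≤ q → IsFockCarleson α 1 q μ,
        ∃ δ, 0 < δ ∧ MemLp (averaging δ μ) ∞ volume,
        ∀ δ, 0 < δ → MemLp (averaging δ μ) ∞ volume,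
        ∃ t, 0 < t ∧ MemLp (berezin α t μ) ∞ volume,
        ∀ t, 0 < t → MemLp (berezin α t μ) ∞ volume,
        ∃ r, 0 < r ∧ ∃ z : ℕ → Cn n, IsHalfLattice r z ∧ (⨆ k, averaging r μ (z k)) < ∞,
        ∀ r, 0 < r → ∀ z : ℕ → Cn n, IsHalfLattice r z → (⨆ k, averaging r μ (z k)) < ∞]) ∧
    (∀ δ t r : ℝ, 0 < δ → 0 < t → 0 < r →
      ∃ C : ℝ≥0, ∀ μ : Measure (Cn n), IsAdmissible α μ →
        ∀ z : ℕ → Cn n, IsHalfLattice r z →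
          ∀ a ∈ [toeplitzNorm α p μ, embeddingNorm α 1 1 μ, eLpNorm (berezin α t μ) ∞ volume,
            eLpNorm (averaging δ μ) ∞ volume, (⨆ k, averaging r μ (z k))],
          ∀ b ∈ [toeplitzNorm α p μ, embeddingNorm α 1 1 μ, eLpNorm (berezin α t μ) ∞ volume,
            eLpNorm (averaging δ μ) ∞ volume, (⨆ k, averaging r μ (z k))],
            a ≤ C * b) := by
  have hp0 : 0 < p := by linarith
  refine ⟨fun μ hμ => ?_, fun δ t r hδ ht hr => ?_⟩
  · have hs := hμ.sFinite hα.le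
    have change {ε : ℝ} (hε : 0 < ε) (h : ⨆ u, averaging ε μ u < ∞) (δ : ℝ) :
        ⨆ u, averaging δ μ u < ∞ := by
      obtain ⟨C, hC⟩ := exists_iSup_averaging_le n δ hε
      exact (hC μ hs).trans_lt (ENNReal.mul_lt_top ENNReal.coe_lt_top h)
    have ofGaussian {c : ℝ} (hc : 0 ≤ c) {B : ℝ≥0∞} (hB : B < ∞)
        (h : ∀ w, gaussianTransform c μ w ≤ B) : ⨆ u, averaging 1 μ u < ∞ :=
      (iSup_averaging_le_of_gaussianTransform_le hc 1 h).trans_lt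
        (ENNReal.mul_lt_top ENNReal.ofReal_lt_top hB)
    -- A single cycle 1, 4, 3, 6, 5, 8, 7, 10, 9, 2: each existential form implies the next
    -- universal one, or finally boundedness on the full domain.
    tfae_have 1 → 4 := by
      rintro ⟨C, hC⟩ q hq
      have hS : ⨆ u, averaging 1 μ u < ∞ := by
        refine ofGaussian hα.le (B := C) ENNReal.coe_lt_top fun w => ?_
        have h := (hC _ (hμ.normalizedFockKernel_mem_toeplitzDomain hα hp0 w)).2
        rw [fockNorm_normalizedFockKernel hα hp0, mul_one] at h
        exact (hμ.gaussianTransform_le_fockSupNorm w).trans h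
      obtain ⟨D, hD⟩ := exists_weightedIntegral_le_averaging n hα (hp.trans hq) one_pos
      refine ⟨(D * ⨆ u, averaging 1 μ u).toNNReal, fun f hf => ?_⟩
      rw [ENNReal.coe_toNNReal (ENNReal.mul_ne_top ENNReal.coe_ne_top hS.ne)]
      exact hD μ hs f hf
    tfae_have 4 → 3 := fun h => ⟨p, le_rfl, h p le_rfl⟩
    tfae_have 3 → 6 := by
      rintro ⟨q, hq, C, hC⟩ δ _
      have hq0 : 0 < q := by linarith
      rw [memLp_averaging_iff]
      refine change one_pos (ofGaussian (by positivity : 0 ≤ α * q / 2) (B := C)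
        ENNReal.coe_lt_top fun w => ?_) δ
      have h := hC _ (normalizedFockKernel_mem_fockSpace hα one_pos w)
      rwa [fockNorm_normalizedFockKernel hα one_pos, ENNReal.one_rpow, mul_one,
        weightedIntegral_normalizedFockKernel hq0.le] at h
    tfae_have 6 → 5 := fun h => ⟨1, one_pos, h 1 one_pos⟩
    tfae_have 5 → 8 := by
      rintro ⟨δ, hδ, h⟩ t ht
      rw [memLp_averaging_iff] at h
      obtain ⟨C, hC⟩ :=
        exists_gaussianTransform_le_averaging n (by positivity : 0 < t * α / 2) hδ
      have he : berezin α t μ = gaussianTransform (t * α / 2) μ := funext (berezin_eq ht.le α μ)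
      refine ⟨?_, (eLpNorm_berezin_le fun w => ?_).trans_lt
        (ENNReal.mul_lt_top (ENNReal.coe_lt_top (r := C)) h)⟩
      · rw [he]
        exact (measurable_gaussianTransform _ μ).aestronglyMeasurable
      · rw [he]
        exact hC μ hs w
    tfae_have 8 → 7 := fun h => ⟨1, one_pos, h 1 one_pos⟩
    tfae_have 7 → 10 := by
      rintro ⟨t, ht, h⟩ r _ z _
      exact (iSup_le fun k => le_iSup (averaging r μ) (z k)).trans_lt
        ((iSup_averaging_le_eLpNorm_berezin hα.le ht.le r μ).trans_lt
          (ENNReal.mul_lt_top ENNReal.ofReal_lt_top h.2))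
    tfae_have 10 → 9 := fun h => by
      obtain ⟨z, hz⟩ := exists_isHalfLattice hn one_pos
      exact ⟨1, one_pos, z, hz, h 1 one_pos z hz⟩
    tfae_have 9 → 2 := by
      rintro ⟨r, hr, z, hz, h⟩
      exact toeplitz_bounded_of_averaging hα hp (half_pos hr)
        ((iSup_averaging_le_iSup_lattice hz μ).trans_lt h)
    tfae_have 2 → 1 := fun h => h.2
    tfae_finish
  · obtain ⟨C, hC⟩ := exists_quantities_comparable n hα hp hδ ht hr
    -- One factor `C` passes from `a` to S, the other from S to `b`.
    refine ⟨C * C, fun μ hμ z hz a ha b hb => ?_⟩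
    rw [ENNReal.coe_mul, mul_assoc]
    exact (hC μ hμ z hz a ha).1.trans (mul_le_mul_right (hC μ hμ z hz b hb).2 _)
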